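/- Let $d\ge 0$ be an integer, let $\{X_t\}_{t\in[0,1]^d}$ be a real-valued Gaussian process on a probability space $(\Omega,\mathfrak F,\mathbb P)$ which is jointly measurable (that is, $(\omega,t)\mapsto X_t(\omega)$ is measurable), with measurable mean function $\mu(t)=\mathbb E X_t$ and unit variances $\operatorname{Var}(X_t)=1$. Let $\Lambda$ be Lebesgue measure on $[0,1]^d$, let $\overline\Phi$ be the upper-tail distribution function of a standard Gaussian variable, let $\alpha\in(0,1)$, and let $\beta:[0,\infty)\to[0,\infty)$ be a function for which at least one of the following holds: 1. $\beta(x)=x$ for all $x\ge 0$, and $\operatorname{Cov}(X_s,X_t)\ge 0$ for all $s,t\in[0,1]^d$; 2. $\beta(x)=\int_{(0,x]}u\,d\nu(u)$ for all $x\ge 0$, where $\nu$ is some probability distribution on $(0,\infty)$ (no assumption is made on the covariance function). For $r\ge 0$ put $L(r)=\{t\in[0,1]^d:\overline\Phi(X_t)\le\alpha\beta(r)\}$, a random subset of $[0,1]^d$. Then for every $\omega\in\Omega$ the maximum $$\hat r=\max\{r\in[0,1]:\Lambda(L(r))\ge r\}$$ exists; the rejection set $R=L(\hat r)$ of the step-up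 procedure is a multiple testing procedure, that is, $\{(\omega,t):t\in R(\omega)\}$ is measurable in $\Omega\times[0,1]^d$; and its false discovery rate for the null hypotheses "$\mu(t)\le 0$", $t\in[0,1]^d$, is well defined and at most $\alpha$: $$\mathbb E\left[\frac{\Lambda\big(\{t\in[0,1]^d:\mu(t)\le 0,\ \overline\Phi(X_t)\le\alpha\beta(\hat r)\}\big)}{\Lambda\big(\{t\in[0,1]^d:\overline\Phi(X_t)\le\alpha\beta(\hat r)\}\big)}\right]\le\alpha,$$ where the ratio is taken to be $0$ when its denominator is $0$. -/

import Mathlib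

open MeasureTheory ProbabilityTheory

namespace ContFDR

noncomputable section

/-- The sub-level set of a family of p-values `p` at the (index dependent) threshold `Δ · r`. -/
def levelSet {H : Type*} (p : H → ℝ) (Δ : H → ℝ → ℝ) (r : ℝ) : Set H :=
  {h | p h ≤ Δ h r}

/-- The number `r̂`: the largest `r ≥ 0` such that the sub-level set with parameter `r` has
volume at least `r`. It is written as a supremum; that it is attained is part of the theorem. -/
def stepUpRadius {H : Type*} [MeasurableSpace H] (Λ : Measure H) (p : H → ℝ)
    (Δ : H → ℝ → ℝ) : ℝ :=
  sSup {r : ℝ | 0 ≤ r ∧ r ≤ Λ.real (levelSet p Δ r)}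

/-- The rejection set of the step-up procedure associated with the threshold function `Δ`. -/
def stepUp {H : Type*} [MeasurableSpace H] (Λ : Measure H) (p : H → ℝ)
    (Δ : H → ℝ → ℝ) : Set H :=
  levelSet p Δ (stepUpRadius Λ p Δ)

/-- The threshold function of product form with level `α`, weight function `w` and shape
function `β`. -/
def productThreshold {H : Type*} (α : ℝ) (w : H → ℝ) (β : ℝ → ℝ) : H → ℝ → ℝ :=
  fun h r => α * w h * β r

/-- A random rejection set is a multiple testing procedure if its membership indicator is a
(jointly) measurable process. -/
def IsTestingProcedure {Ω H : Type*} [MeasurableSpace Ω] [MeasurableSpace H]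
    (R : Ω → Set H) : Prop :=
  MeasurableSet {q : Ω × H | q.2 ∈ R q.1}

/-- The false discovery proportion of the rejection set `R` when `H₀` is the set of true nulls.
It is zero if `R` has volume zero, because `x / 0 = 0` in Lean. -/
def fdp {H : Type*} [MeasurableSpace H] (Λ : Measure H) (H₀ R : Set H) : ℝ :=
  Λ.real (R ∩ H₀) / Λ.real R

/-- The false discovery rate of the random rejection set `R` under the distribution `P`. -/
def fdr {Ω H : Type*} [MeasurableSpace Ω] [MeasurableSpace H] (P : Measure Ω) (Λ : Measure H)
    (H₀ : Set H) (R : Ω → Set H) : ℝ :=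
  ∫ ω, fdp Λ H₀ (R ω) ∂P

/-- The shape function `x ↦ ∫₀ˣ u dν(u)`; the upper end point is included, which makes the
function right-continuous also if `ν` has atoms. -/
def shapeOf (ν : Measure ℝ) (x : ℝ) : ℝ :=
  ∫ u in Set.Ioc 0 x, u ∂ν

/-- The upper-tail distribution function `Φ̄` of a standard Gaussian variable. -/
def gaussianUpperTail (x : ℝ) : ℝ :=
  (gaussianReal 0 1).real (Set.Ioi x)

/-- The unit cube `[0,1]^d`. Its `volume` is the product of the Lebesgue measures on `[0,1]`,
that is, `d`-dimensional Lebesgue measure. -/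
abbrev Cube (d : ℕ) : Type := Fin d → unitInterval

/-- The step-up procedure for the p-values `Φ̄(X_t)` on the unit cube with Lebesgue measure,
weight function `1`, level `α` and shape function `β`. -/
def gaussianStepUp {Ω : Type*} {d : ℕ} (X : Cube d → Ω → ℝ) (α : ℝ) (β : ℝ → ℝ) (ω : Ω) :
    Set (Cube d) :=
  stepUp volume (fun t => gaussianUpperTail (X t ω)) (productThreshold α (fun _ => 1) β)

/-- The random threshold parameter `r̂(X)` of `gaussianStepUp`. -/
def gaussianRadius {Ω : Type*} {d : ℕ} (X : Cube d → Ω → ℝ) (α : ℝ) (β : ℝ → ℝ) (ω : Ω) : ℝ :=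
  stepUpRadius (volume : Measure (Cube d)) (fun t => gaussianUpperTail (X t ω))
    (productThreshold α (fun _ => 1) β)

end

end ContFDR

/-!
Write `p_t = Φ̄ (X_t)` and let `b` be the threshold `r ↦ α β r`, extended to a monotone
right-continuous function on the line.

*The radius.* The largest `r` with `r ≤ Λ {p ≤ b r}` is the limit of the decreasing iteration
`r₀ = 1`, `r_{n+1} = Λ {p ≤ b r_n}` (`stepUpRadius_spec`): right-continuity of `b` makes the limit a
fixed point, and monotonicity keeps every competitor below all iterates. So the maximum exists, the
rejection set has volume exactly `r̂`, and `r̂` is measurable in `ω` (`measurable_stepUpRadius`).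

*Reduction to one hypothesis.* As `Λ R = r̂`, the false discovery proportion is the integral of
`1{p_t ≤ b r̂} / r̂` over the true nulls `t`, and by Tonelli it suffices that
`E[1{p_t ≤ b r̂} / r̂] ≤ α` for each of them (`fdr_stepUp_le`).

*Arbitrary dependence.* If `β x = ∫_{(0,x]} u dν(u)`, then `1 / r̂ = ∫_{v > r̂} v⁻² dv` and
`P (p_t ≤ α β v) ≤ α β v` bound this expectation by `α ∫ v⁻² β v dv = α`
(`lintegral_rejectionWeight_shapeOf_le`).

*Nonnegative covariances.* If `β x = x`, regress on `X_t`: `X_s = Z_s + c_s X_t` with `c_s ≥ 0` and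
the path `Z` independent of `X_t`. Given `Z`, the radius is a nondecreasing function of `X_t`, so
the rejection event is a half-line, on which `r̂` is at least `1 / α` times its probability
(`gaussianReal_tail_le`, `lintegral_rejectionWeight_gaussianReal_le`). Conditioning on `Z` requires
the radius to be a measurable function of `X_t` and the path `Z`. Evaluation of a path is not
measurable over an uncountable index set, but a jointly measurable process agrees almost everywhere
with a measurable functional of its path and the index (`exists_measurable_path_version`).
-/

namespace ContFDR

open Filter Set
open scoped ENNReal Topology

/-! ### The step-up radius as the limit of a decreasing iteration -/

section Radius

variable {H : Type*} [MeasurableSpace H] {Λ : Measure H} {p : H → ℝ} {b : ℝ → ℝ}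

/-- The iteration `r ↦ Λ {p ≤ b r}` started at `1`. For a monotone right-continuous `b` it decreases
to the largest fixed point, which is the step-up radius. -/
noncomputable def radiusIter (Λ : Measure H) (p : H → ℝ) (b : ℝ → ℝ) : ℕ → ℝ
  | 0 => 1
  | n + 1 => Λ.real {h | p h ≤ b (radiusIter Λ p b n)}

lemma measureReal_sublevel_mono [IsProbabilityMeasure Λ] (hb : Monotone b) :
    Monotone fun r => Λ.real {h | p h ≤ b r} := fun _ _ hrs =>
  measureReal_mono fun _ (hh : p _ ≤ b _) => hh.trans (hb hrs)

lemma radiusIter_antitone [IsProbabilityMeasure Λ] (hb : Monotone b) :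
    Antitone (radiusIter Λ p b) := by
  refine antitone_nat_of_succ_le fun n => ?_
  induction n with
  | zero => exact measureReal_le_one
  | succ n ih => exact measureReal_sublevel_mono hb ih

lemma radiusIter_nonneg (n : ℕ) : 0 ≤ radiusIter Λ p b n := by
  cases n with
  | zero => exact zero_le_one
  | succ n => exact measureReal_nonneg

lemma le_radiusIter [IsProbabilityMeasure Λ] (hb : Monotone b) {r : ℝ}
    (hr : r ≤ Λ.real {h | p h ≤ b r}) (n : ℕ) : r ≤ radiusIter Λ p b n := by
  induction n with
  | zero => exact hr.trans measureReal_le_one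
  | succ n ih => exact hr.trans (measureReal_sublevel_mono hb ih)

lemma exists_tendsto_radiusIter [IsProbabilityMeasure Λ] (hp : Measurable p) (hb : Monotone b)
    (hbc : ∀ x, ContinuousWithinAt b (Ici x) x) :
    ∃ r, 0 ≤ r ∧ Tendsto (radiusIter Λ p b) atTop (𝓝 r) ∧ r = Λ.real {h | p h ≤ b r} := by
  have hanti : Antitone (radiusIter Λ p b) := radiusIter_antitone hb
  have hbdd : BddBelow (range (radiusIter Λ p b)) :=
    ⟨0, by rintro _ ⟨n, rfl⟩; exact radiusIter_nonneg n⟩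
  have hlim := tendsto_atTop_ciInf hanti hbdd
  set r := ⨅ n, radiusIter Λ p b n
  have hle : ∀ n, r ≤ radiusIter Λ p b n := fun n => ciInf_le hbdd n
  refine ⟨r, le_ciInf fun n => radiusIter_nonneg n, hlim, ?_⟩
  have hbr : Tendsto (fun n => b (radiusIter Λ p b n)) atTop (𝓝 (b r)) :=
    (hbc r).tendsto.comp
      (tendsto_nhdsWithin_iff.2 ⟨hlim, Eventually.of_forall hle⟩)
  have hset : {h | p h ≤ b r} = ⋂ n, {h | p h ≤ b (radiusIter Λ p b n)} := by
    ext h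
    simp only [mem_ofPred_eq, mem_iInter]
    exact ⟨fun hh n => hh.trans (hb (hle n)), fun hh => ge_of_tendsto' hbr hh⟩
  have hmeas : Tendsto (fun n => Λ {h | p h ≤ b (radiusIter Λ p b n)}) atTop
      (𝓝 (Λ {h | p h ≤ b r})) := by
    rw [hset]
    refine tendsto_measure_iInter_atTop
      (fun n => (measurableSet_le hp measurable_const).nullMeasurableSet) ?_
      ⟨0, measure_ne_top _ _⟩
    exact fun m n hmn h (hh : p h ≤ _) => hh.trans (hb (hanti hmn))
  have hreal := (ENNReal.tendsto_toReal (measure_ne_top Λ _)).comp hmeas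
  exact tendsto_nhds_unique ((tendsto_add_atTop_iff_nat 1).2 hlim) hreal

lemma stepUpRadius_spec [IsProbabilityMeasure Λ] (hp : Measurable p) (hb : Monotone b)
    (hbc : ∀ x, ContinuousWithinAt b (Ici x) x) :
    IsGreatest {r : ℝ | 0 ≤ r ∧ r ≤ Λ.real {h | p h ≤ b r}} (stepUpRadius Λ p fun _ => b) ∧
      Tendsto (radiusIter Λ p b) atTop (𝓝 (stepUpRadius Λ p fun _ => b)) ∧
      Λ.real {h | p h ≤ b (stepUpRadius Λ p fun _ => b)} = stepUpRadius Λ p fun _ => b := by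
  obtain ⟨r, hr0, hlim, hr⟩ := exists_tendsto_radiusIter (Λ := Λ) hp hb hbc
  have hgreat : IsGreatest {r : ℝ | 0 ≤ r ∧ r ≤ Λ.real {h | p h ≤ b r}} r :=
    ⟨⟨hr0, hr.le⟩, fun s hs => ge_of_tendsto' hlim fun n => le_radiusIter hb hs.2 n⟩
  have : stepUpRadius Λ p (fun _ => b) = r := hgreat.csSup_eq
  rw [this]
  exact ⟨hgreat, hlim, hr.symm⟩

lemma stepUpRadius_nonneg [IsProbabilityMeasure Λ] (hp : Measurable p) (hb : Monotone b)
    (hbc : ∀ x, ContinuousWithinAt b (Ici x) x) : 0 ≤ stepUpRadius Λ p fun _ => b :=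
  (stepUpRadius_spec hp hb hbc).1.1.1

lemma stepUpRadius_le_of_le [IsProbabilityMeasure Λ] {q : H → ℝ} (hp : Measurable p)
    (hq : Measurable q) (hb : Monotone b) (hbc : ∀ x, ContinuousWithinAt b (Ici x) x)
    (hqp : ∀ h, q h ≤ p h) :
    (stepUpRadius Λ p fun _ => b) ≤ stepUpRadius Λ q fun _ => b := by
  have h1 := (stepUpRadius_spec (Λ := Λ) hp hb hbc).1.1
  refine (stepUpRadius_spec (Λ := Λ) hq hb hbc).1.2 ⟨h1.1, h1.2.trans ?_⟩
  exact measureReal_mono fun h (hh : p h ≤ _) => (hqp h).trans hh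

/-- Only the volumes of the sub-level sets enter the step-up radius, so changing the p-values on a
null set does not affect it. -/
lemma stepUpRadius_congr_ae {q : H → ℝ} (hpq : p =ᵐ[Λ] q) :
    (stepUpRadius Λ p fun _ => b) = stepUpRadius Λ q fun _ => b := by
  have (r : ℝ) : Λ.real {h | p h ≤ b r} = Λ.real {h | q h ≤ b r} := by
    refine measureReal_congr ?_
    filter_upwards [hpq] with h hh
    exact congrArg (· ≤ b r) hh
  simp only [stepUpRadius, levelSet, this]

/-- The values of `Δ` at negative parameters do not enter the step-up radius. -/
lemma stepUpRadius_congr_threshold {Δ Δ' : H → ℝ → ℝ} (h : ∀ t r, 0 ≤ r → Δ t r = Δ' t r) :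
    stepUpRadius Λ p Δ = stepUpRadius Λ p Δ' := by
  unfold stepUpRadius levelSet
  congr 1
  ext r
  refine and_congr_right fun hr => ?_
  simp only [h _ r hr]

lemma measurable_stepUpRadius {Θ : Type*} [MeasurableSpace Θ] [IsProbabilityMeasure Λ]
    {p : Θ × H → ℝ} (hp : Measurable p) (hb : Monotone b)
    (hbc : ∀ x, ContinuousWithinAt b (Ici x) x) :
    Measurable fun θ => stepUpRadius Λ (fun h => p (θ, h)) fun _ => b := by
  have hiter (n : ℕ) : Measurable fun θ => radiusIter Λ (fun h => p (θ, h)) b n := by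
    induction n with
    | zero => exact measurable_const
    | succ n ih =>
      have hset : MeasurableSet
          {q : Θ × H | p q ≤ b (radiusIter Λ (fun h => p (q.1, h)) b n)} :=
        measurableSet_le hp (hb.measurable.comp (ih.comp measurable_fst))
      exact (measurable_measure_prodMk_left hset).ennreal_toReal
  refine measurable_of_tendsto_metrizable hiter (tendsto_pi_nhds.2 fun θ => ?_)
  exact (stepUpRadius_spec (hp.comp measurable_prodMk_left) hb hbc).2.1

end Radius

/-! ### Gaussian tails -/

lemma antitone_gaussianUpperTail : Antitone gaussianUpperTail := fun _ _ h =>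
  measureReal_mono (Ioi_subset_Ioi h)

lemma gaussianUpperTail_pos (x : ℝ) : 0 < gaussianUpperTail x := by
  have : volume (Ioi x) ≠ 0 := by simp
  have h : gaussianReal 0 1 (Ioi x) ≠ 0 := fun h =>
    this (gaussianReal_absolutelyContinuous' 0 one_ne_zero h)
  exact ENNReal.toReal_pos h (measure_ne_top _ _)

lemma gaussianReal_Ici (x : ℝ) :
    gaussianReal 0 1 (Ici x) = ENNReal.ofReal (gaussianUpperTail x) := by
  have := nullSingletonClass_gaussianReal (μ := 0) (v := 1) one_ne_zero
  rw [gaussianUpperTail, ofReal_measureReal, measure_congr Ioi_ae_eq_Ici]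

/-- The set where the p-value `Φ̄ (x + m)`, `m ≤ 0`, is below a nondecreasing threshold `v` has
Gaussian measure at most *every* value of `v` on that set. The set is an upper set, and for each of
its points `a` the half-line `[a, ∞)` has measure `Φ̄ a ≤ Φ̄ (a + m) ≤ v a`. -/
lemma gaussianReal_tail_le {v : ℝ → ℝ} (hv : Monotone v) {m : ℝ} (hm : m ≤ 0) {a : ℝ}
    (ha : gaussianUpperTail (a + m) ≤ v a) :
    gaussianReal 0 1 {x | gaussianUpperTail (x + m) ≤ v x} ≤ ENNReal.ofReal (v a) := by
  set A := {x | gaussianUpperTail (x + m) ≤ v x}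
  have hup : IsUpperSet A := fun x y hxy (hx : _ ≤ _) =>
    (antitone_gaussianUpperTail (by linarith : x + m ≤ y + m)).trans (hx.trans (hv hxy))
  have hA : MeasurableSet A := hup.ordConnected.measurableSet
  rw [hA.measure_eq_iSup_isCompact]
  refine iSup₂_le fun K hKA => iSup_le fun hK => ?_
  -- the least element of `K ∪ {a}` bounds `K` from below and lies in `A`
  obtain ⟨x, hx, hmin⟩ := (hK.insert a).exists_isLeast (insert_nonempty a K)
  have haA : a ∈ A := ha
  have hxA : x ∈ A := insert_subset haA hKA hx
  calc gaussianReal 0 1 K ≤ gaussianReal 0 1 (Ici x) :=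
        measure_mono fun y hy => hmin (mem_insert_of_mem a hy)
    _ = ENNReal.ofReal (gaussianUpperTail x) := gaussianReal_Ici x
    _ ≤ ENNReal.ofReal (v a) := by
        refine ENNReal.ofReal_le_ofReal ?_
        calc gaussianUpperTail x ≤ gaussianUpperTail (x + m) :=
              antitone_gaussianUpperTail (by linarith)
          _ ≤ v x := hxA
          _ ≤ v a := hv (hmin (mem_insert a K))

/-! ### Jointly measurable processes as measurable functionals of their path -/

section Path

variable {Ω S : Type*} [MeasurableSpace Ω] [MeasurableSpace S]

/-- If every section `f (·, s)` of a bounded jointly measurable `f` is a function of `T`, then `f`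
agrees almost everywhere with a jointly measurable function of `T` and `s`. -/
lemma exists_measurable_path_version_of_bounded (P : Measure Ω) [IsProbabilityMeasure P]
    (Λ : Measure S) [IsProbabilityMeasure Λ] {f : Ω × S → ℝ} (hf : Measurable f) {C : ℝ}
    (hC : ∀ q, |f q| ≤ C) {W : Type*} [MeasurableSpace W] {T : Ω → W} (hT : Measurable T)
    (hfT : ∀ s, ∃ e : W → ℝ, Measurable e ∧ ∀ ω, f (ω, s) = e (T ω)) :
    ∃ h : W × S → ℝ, Measurable h ∧ ∀ᵐ q ∂(P.prod Λ), f q = h (T q.1, q.2) := by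
  set φ : Ω × S → W × S := fun q => (T q.1, q.2)
  have hφ : Measurable φ := (hT.comp measurable_fst).prodMk measurable_snd
  set Q := P.prod Λ
  have hfint : Integrable f Q := Integrable.of_bound hf.aestronglyMeasurable C
    (Eventually.of_forall hC)
  obtain ⟨h, hh, hh_eq⟩ :=
    (stronglyMeasurable_condExp (μ := Q) (m := MeasurableSpace.comap φ inferInstance)
      (f := f)).measurable.exists_eq_measurable_comp
  refine ⟨h, hh, ?_⟩
  set D : Ω × S → ℝ := fun q => f q - h (φ q)
  have hDm : Measurable D := hf.sub (hh.comp hφ)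
  have hcond (q : Ω × S) : Q[f|MeasurableSpace.comap φ inferInstance] q = h (φ q) :=
    congrFun hh_eq q
  have hhC : ∀ᵐ q ∂Q, |h (φ q)| ≤ C := by
    have := ae_bdd_abs_condExp_of_ae_bdd_abs (μ := Q)
      (m := MeasurableSpace.comap φ inferInstance) (R := C) (f := f) (Eventually.of_forall hC)
    filter_upwards [this] with q hq
    rwa [← hcond]
  have hDint : Integrable D Q := Integrable.of_bound hDm.aestronglyMeasurable (C + C) (by
    filter_upwards [hhC] with q hq
    exact (norm_sub_le _ _).trans (add_le_add (hC q) hq))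
  -- it suffices to test against measurable rectangles
  suffices hrect : ∀ A : Set Ω, MeasurableSet A → ∀ B : Set S, MeasurableSet B →
      ∫ q in A ×ˢ B, D q ∂Q = 0 by
    have hall : ∀ U, MeasurableSet U → ∫ q in U, D q ∂Q = 0 := by
      intro U hU
      induction U, hU using MeasurableSpace.induction_on_inter generateFrom_prod.symm
        isPiSystem_prod with
      | empty => simp
      | basic U hU =>
        obtain ⟨A, hA, B, hB, rfl⟩ := hU
        exact hrect A hA B hB
      | compl U hU ih =>
        have h1 := integral_add_compl hU hDint
        have h2 := hrect univ .univ univ .univ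
        rw [univ_prod_univ, setIntegral_univ] at h2
        rw [ih, h2, zero_add] at h1
        exact h1
      | iUnion U hdisj hU ih =>
        rw [integral_iUnion hU hdisj hDint.integrableOn]
        simp [ih]
    have := Integrable.ae_eq_zero_of_forall_setIntegral_eq_zero hDint
      (fun U hU _ => hall U hU)
    filter_upwards [this] with q hq
    exact sub_eq_zero.1 hq
  intro A hA B hB
  -- replace the indicator of `A` by its conditional expectation given `T`;
  -- this is possible because each section `D (·, s)` is a function of `T`
  set a : Ω → ℝ := A.indicator fun _ => (1 : ℝ)
  have haint : Integrable a P := (integrable_const (1 : ℝ)).indicator hA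
  set g : Ω → ℝ := P[a|MeasurableSpace.comap T inferInstance]
  have hgm : StronglyMeasurable[MeasurableSpace.comap T inferInstance] g :=
    stronglyMeasurable_condExp
  have hgint : Integrable g P := integrable_condExp
  set G : Ω × S → ℝ := fun q => g q.1 * B.indicator (fun _ => (1 : ℝ)) q.2
  have hGint : Integrable G Q :=
    hgint.mul_prod ((integrable_const (1 : ℝ)).indicator hB)
  have hGm : StronglyMeasurable[MeasurableSpace.comap φ inferInstance] G := by
    obtain ⟨g', hg', hgg'⟩ := hgm.measurable.exists_eq_measurable_comp
    have h1 : Measurable fun q : W × S => g' q.1 * B.indicator (fun _ => (1 : ℝ)) q.2 :=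
      (hg'.comp measurable_fst).mul
        ((measurable_const.indicator hB).comp measurable_snd)
    have h2 : G = (fun q : W × S => g' q.1 * B.indicator (fun _ => (1 : ℝ)) q.2) ∘ φ := by
      ext q
      simp only [G, φ, hgg', Function.comp_apply]
    rw [h2]
    exact (h1.comp (comap_measurable _)).stronglyMeasurable
  have hGf : Integrable (G * f) Q := hGint.mul_bdd (c := C) hf.aestronglyMeasurable
    (Eventually.of_forall hC)
  have hGD : Integrable (fun q => G q * D q) Q :=
    hGint.mul_bdd (c := C + C) hDm.aestronglyMeasurable
    (by filter_upwards [hhC] with q hq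
        exact (norm_sub_le _ _).trans (add_le_add (hC q) hq))
  have hzero : ∫ q, G q * D q ∂Q = 0 := by
    have h1 : Q[G * f|MeasurableSpace.comap φ inferInstance] =ᵐ[Q]
        G * Q[f|MeasurableSpace.comap φ inferInstance] :=
      condExp_mul_of_stronglyMeasurable_left hGm hGf hfint
    have h2 : ∫ q, (G * f) q ∂Q = ∫ q, (G * Q[f|MeasurableSpace.comap φ inferInstance]) q ∂Q := by
      rw [← integral_condExp hφ.comap_le, integral_congr_ae h1]
    have h3 : Integrable (G * Q[f|MeasurableSpace.comap φ inferInstance]) Q :=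
      integrable_condExp.congr h1
    have h4 : (fun q => G q * D q) = G * f - G * Q[f|MeasurableSpace.comap φ inferInstance] := by
      ext q
      simp only [D, Pi.sub_apply, Pi.mul_apply, hcond]
      ring
    rw [h4, integral_sub' hGf h3, h2, sub_self]
  have hsec : ∀ᵐ s ∂Λ, ∫ ω, a ω * D (ω, s) ∂P = ∫ ω, g ω * D (ω, s) ∂P := by
    filter_upwards [hDint.prod_left_ae] with s hs
    have hDs : StronglyMeasurable[MeasurableSpace.comap T inferInstance] fun ω => D (ω, s) := by
      obtain ⟨e, he, hfe⟩ := hfT s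
      have h1 : Measurable fun w => e w - h (w, s) := he.sub (hh.comp measurable_prodMk_right)
      have h2 : (fun ω => D (ω, s)) = (fun w => e w - h (w, s)) ∘ T := by
        ext ω
        simp only [D, φ, hfe, Function.comp_apply]
      rw [h2]
      exact (h1.comp (comap_measurable _)).stronglyMeasurable
    have h1 : Integrable (a * fun ω => D (ω, s)) P := by
      refine hs.bdd_mul (c := 1) haint.aestronglyMeasurable (Eventually.of_forall fun ω => ?_)
      simp only [a, indicator]
      split_ifs <;> simp
    have h2 := condExp_mul_of_stronglyMeasurable_right hDs h1 haint
    calc ∫ ω, a ω * D (ω, s) ∂P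
        = ∫ ω, (P[a * fun ω => D (ω, s)|MeasurableSpace.comap T inferInstance]) ω ∂P :=
          (integral_condExp hT.comap_le).symm
      _ = ∫ ω, g ω * D (ω, s) ∂P := integral_congr_ae h2
  have haD : Integrable (fun q : Ω × S =>
      (a q.1 * B.indicator (fun _ => (1 : ℝ)) q.2) * D q) Q := by
    refine (haint.mul_prod ((integrable_const (1 : ℝ)).indicator hB)).mul_bdd (c := C + C)
      hDm.aestronglyMeasurable ?_
    filter_upwards [hhC] with q hq
    exact (norm_sub_le _ _).trans (add_le_add (hC q) hq)
  calc ∫ q in A ×ˢ B, D q ∂Q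
      = ∫ q, (a q.1 * B.indicator (fun _ => (1 : ℝ)) q.2) * D q ∂Q := by
        rw [← integral_indicator (hA.prod hB)]
        congr 1 with q
        by_cases h1 : q.1 ∈ A <;> by_cases h2 : q.2 ∈ B <;> simp [a, indicator, h1, h2]
    _ = ∫ s, ∫ ω, (a ω * B.indicator (fun _ => (1 : ℝ)) s) * D (ω, s) ∂P ∂Λ :=
        integral_prod_symm _ haD
    _ = ∫ s, ∫ ω, G (ω, s) * D (ω, s) ∂P ∂Λ := by
        refine integral_congr_ae ?_
        filter_upwards [hsec] with s hs
        simp only [G, mul_right_comm _ (B.indicator (fun _ => (1 : ℝ)) s), integral_mul_const, hs]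
    _ = 0 := by rw [← hzero]; exact (integral_prod_symm _ hGD).symm

/-- The evaluation `(path, s) ↦ path s` is not measurable for the product σ-algebra on paths over an
uncountable index set. Still, a jointly measurable process agrees almost everywhere with a jointly
measurable functional of its path and the index: by Fubini, the process differs from its conditional
expectation given (path, index) by a function that integrates to zero over every rectangle. -/
lemma exists_measurable_path_version (P : Measure Ω) [IsProbabilityMeasure P]
    (Λ : Measure S) [IsProbabilityMeasure Λ] {Y : Ω × S → ℝ} (hY : Measurable Y) :
    ∃ h : (S → ℝ) × S → ℝ, Measurable h ∧
      ∀ᵐ ω ∂P, ∀ᵐ s ∂Λ, Y (ω, s) = h (fun s => Y (ω, s), s) := by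
  have hT : Measurable fun ω => fun s => Y (ω, s) :=
    measurable_pi_lambda _ fun s => hY.comp measurable_prodMk_right
  -- compose with `arctan` to obtain a bounded process
  obtain ⟨h, hh, hh'⟩ := exists_measurable_path_version_of_bounded P Λ
    (Real.measurable_arctan.comp hY) (C := Real.pi / 2)
    (fun q => abs_le.2 ⟨(Real.neg_pi_div_two_lt_arctan _).le, (Real.arctan_lt_pi_div_two _).le⟩)
    hT (fun s => ⟨fun w => Real.arctan (w s),
      Real.measurable_arctan.comp (measurable_pi_apply s), fun _ => rfl⟩)
  have htan : Measurable Real.tan := by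
    simp only [funext Real.tan_eq_sin_div_cos]
    fun_prop
  refine ⟨fun q => Real.tan (h q), htan.comp hh, ?_⟩
  filter_upwards [Measure.ae_ae_of_ae_prod hh'] with ω hω
  filter_upwards [hω] with s hs
  rw [← hs, Function.comp_apply, Real.tan_arctan]

end Path

/-! ### The false discovery rate as an integral over the null hypotheses -/

section FDR

variable {Ω H : Type*} [MeasurableSpace Ω] [MeasurableSpace H]

open Classical in
/-- The contribution of a hypothesis with p-value `p` to the false discovery proportion, if the
rejection set has volume `v` and threshold `b v`: it is `1 / v` if the hypothesis is rejected and
`0` otherwise. -/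
noncomputable def rejectionWeight (b : ℝ → ℝ) (p v : ℝ) : ℝ≥0∞ :=
  if p ≤ b v then (ENNReal.ofReal v)⁻¹ else 0

lemma measurable_rejectionWeight {b : ℝ → ℝ} (hb : Measurable b) :
    Measurable fun q : ℝ × ℝ => rejectionWeight b q.1 q.2 :=
  Measurable.ite (measurableSet_le measurable_fst (hb.comp measurable_snd))
    (measurable_snd.ennreal_ofReal.inv) measurable_const

lemma fdp_nonneg (Λ : Measure H) (H₀ R : Set H) : 0 ≤ fdp Λ H₀ R :=
  div_nonneg measureReal_nonneg measureReal_nonneg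

variable {P : Measure Ω} {Λ : Measure H} [IsProbabilityMeasure Λ] {p : Ω × H → ℝ} {b : ℝ → ℝ}

lemma measurableSet_stepUp (hp : Measurable p) (hb : Monotone b)
    (hbc : ∀ x, ContinuousWithinAt b (Ici x) x) :
    MeasurableSet {q : Ω × H | q.2 ∈ stepUp Λ (fun h => p (q.1, h)) fun _ => b} :=
  measurableSet_le hp
    (hb.measurable.comp ((measurable_stepUpRadius hp hb hbc).comp measurable_fst))

lemma fdp_le_one (H₀ R : Set H) : fdp Λ H₀ R ≤ 1 :=
  div_le_one_of_le₀ (measureReal_mono inter_subset_left) measureReal_nonneg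

lemma integrable_fdp [IsFiniteMeasure P] {R : Ω → Set H} (hR : IsTestingProcedure R) {H₀ : Set H}
    (hH₀ : MeasurableSet H₀) : Integrable (fun ω => fdp Λ H₀ (R ω)) P := by
  have h1 : Measurable fun ω => Λ.real (R ω) := (measurable_measure_prodMk_left hR).ennreal_toReal
  have h2 : Measurable fun ω => Λ.real (R ω ∩ H₀) :=
    (measurable_measure_prodMk_left (hR.inter (hH₀.preimage measurable_snd))).ennreal_toReal
  refine Integrable.of_bound (h2.div h1).aestronglyMeasurable 1 (Eventually.of_forall fun ω => ?_)
  rw [Real.norm_eq_abs, abs_of_nonneg (fdp_nonneg _ _ _)]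
  exact fdp_le_one _ _

/-- The false discovery proportion of a step-up procedure is an integral over the null hypotheses,
because the volume of the rejection set equals the step-up radius. -/
lemma ofReal_fdp_stepUp_le {p : H → ℝ} (hp : Measurable p) (hb : Monotone b)
    (hbc : ∀ x, ContinuousWithinAt b (Ici x) x) (H₀ : Set H) :
    ENNReal.ofReal (fdp Λ H₀ (stepUp Λ p fun _ => b)) ≤
      ∫⁻ h in H₀, rejectionWeight b (p h) (stepUpRadius Λ p fun _ => b) ∂Λ := by
  have hvol : Λ.real (stepUp Λ p fun _ => b) = stepUpRadius Λ p fun _ => b :=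
    (stepUpRadius_spec hp hb hbc).2.2
  have hset : MeasurableSet (stepUp Λ p fun _ => b) := measurableSet_le hp measurable_const
  rw [fdp, hvol]
  set r := stepUpRadius Λ p fun _ => b
  have hr : 0 ≤ r := stepUpRadius_nonneg hp hb hbc
  rcases hr.eq_or_lt with h0 | hpos
  · simp [← h0]
  have hind : (fun h => rejectionWeight b (p h) r) =
      (stepUp Λ p fun _ => b).indicator fun _ => (ENNReal.ofReal r)⁻¹ := by
    ext h
    classical
    simp only [rejectionWeight, indicator_apply]
    rfl
  rw [hind, lintegral_indicator_const hset, Measure.restrict_apply hset,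
    ENNReal.ofReal_div_of_pos hpos, ofReal_measureReal, div_eq_mul_inv, mul_comm]

lemma fdr_stepUp_le [IsProbabilityMeasure P] (hp : Measurable p) (hb : Monotone b)
    (hbc : ∀ x, ContinuousWithinAt b (Ici x) x) {H₀ : Set H} (hH₀ : MeasurableSet H₀) {α : ℝ}
    (hα : 0 ≤ α)
    (hle : ∀ h ∈ H₀, ∫⁻ ω, rejectionWeight b (p (ω, h))
      (stepUpRadius Λ (fun h => p (ω, h)) fun _ => b) ∂P ≤ ENNReal.ofReal α) :
    fdr P Λ H₀ (fun ω => stepUp Λ (fun h => p (ω, h)) fun _ => b) ≤ α := by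
  have hr := measurable_stepUpRadius (Λ := Λ) hp hb hbc
  have hint := integrable_fdp (P := P) (Λ := Λ)
    (R := fun ω => stepUp Λ (fun h => p (ω, h)) fun _ => b) (measurableSet_stepUp hp hb hbc) hH₀
  rw [fdr, integral_eq_lintegral_of_nonneg_ae (Eventually.of_forall fun ω => fdp_nonneg _ _ _)
    hint.aestronglyMeasurable]
  refine ENNReal.toReal_le_of_le_ofReal hα ?_
  have hmeas : Measurable fun q : Ω × H => rejectionWeight b (p q)
      (stepUpRadius Λ (fun h => p (q.1, h)) fun _ => b) :=
    (measurable_rejectionWeight hb.measurable).comp (hp.prodMk (hr.comp measurable_fst))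
  calc ∫⁻ ω, ENNReal.ofReal (fdp Λ H₀ (stepUp Λ (fun h => p (ω, h)) fun _ => b)) ∂P
      ≤ ∫⁻ ω, ∫⁻ h in H₀, rejectionWeight b (p (ω, h))
          (stepUpRadius Λ (fun h => p (ω, h)) fun _ => b) ∂Λ ∂P :=
        lintegral_mono fun ω =>
          ofReal_fdp_stepUp_le (hp.comp measurable_prodMk_left) hb hbc H₀
    _ = ∫⁻ h in H₀, ∫⁻ ω, rejectionWeight b (p (ω, h))
          (stepUpRadius Λ (fun h => p (ω, h)) fun _ => b) ∂P ∂Λ :=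
        lintegral_lintegral_swap hmeas.aemeasurable
    _ ≤ ∫⁻ _ in H₀, ENNReal.ofReal α ∂Λ := setLIntegral_mono measurable_const hle
    _ ≤ ENNReal.ofReal α := by
        rw [setLIntegral_const]
        exact mul_le_of_le_one_right zero_le prob_le_one

end FDR

/-! ### Arbitrary dependence -/

section Shape

variable {ν : Measure ℝ}

lemma integrableOn_id_Ioc [IsFiniteMeasure ν] (x : ℝ) :
    IntegrableOn (fun u => u) (Ioc 0 x) ν := by
  refine Measure.integrableOn_of_bounded (measure_ne_top _ _)
    measurable_id.aestronglyMeasurable (M := x) ?_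
  filter_upwards [ae_restrict_mem measurableSet_Ioc] with u hu
  rw [Real.norm_eq_abs, abs_of_pos hu.1]
  exact hu.2

lemma shapeOf_mono [IsFiniteMeasure ν] : Monotone (shapeOf ν) := fun x y hxy => by
  refine setIntegral_mono_set (integrableOn_id_Ioc y) ?_
    (Ioc_subset_Ioc_right hxy).eventuallyLE
  filter_upwards [ae_restrict_mem measurableSet_Ioc] with u hu using hu.1.le

lemma shapeOf_of_nonpos {x : ℝ} (hx : x ≤ 0) : shapeOf ν x = 0 := by
  simp [shapeOf, Ioc_eq_empty_of_le hx]

lemma continuousWithinAt_shapeOf [IsFiniteMeasure ν] (x : ℝ) :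
    ContinuousWithinAt (shapeOf ν) (Ici x) x := by
  have heq : shapeOf ν = fun y => ∫ u, (Ioc 0 y).indicator (fun u => u) u ∂ν := by
    ext y
    rw [integral_indicator measurableSet_Ioc, shapeOf]
  rw [heq]
  refine continuousWithinAt_of_dominated (bound := (Ioc 0 (x + 1)).indicator fun u => u) ?_ ?_ ?_ ?_
  · exact Eventually.of_forall fun y =>
      (measurable_id.indicator measurableSet_Ioc).aestronglyMeasurable
  · have : ∀ᶠ y in 𝓝[Ici x] x, y ≤ x + 1 :=
      mem_nhdsWithin_of_mem_nhds (Iic_mem_nhds (by linarith))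
    filter_upwards [this] with y hy
    refine Eventually.of_forall fun u => ?_
    by_cases hu : u ∈ Ioc 0 y
    · rw [indicator_of_mem hu, indicator_of_mem (Ioc_subset_Ioc_right hy hu), Real.norm_eq_abs,
        abs_of_pos hu.1]
    · rw [indicator_of_notMem hu, norm_zero]
      exact indicator_nonneg (fun u hu => hu.1.le) u
  · exact (integrable_indicator_iff measurableSet_Ioc).2 (integrableOn_id_Ioc _)
  · refine Eventually.of_forall fun u => ?_
    refine ContinuousWithinAt.congr_of_eventuallyEq continuousWithinAt_const
      (?_ : _ =ᶠ[_] fun _ => (Ioc 0 x).indicator (fun u => u) u) rfl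
    rcases le_or_gt u x with hu | hu
    · filter_upwards [self_mem_nhdsWithin] with y hy
      simp [indicator, hu, hu.trans hy]
    · filter_upwards [mem_nhdsWithin_of_mem_nhds (Iio_mem_nhds hu)] with y hy
      have hy' : ¬ u ≤ y := not_le.2 hy
      simp [indicator, hu.not_ge, hy']

lemma ofReal_shapeOf [IsFiniteMeasure ν] (x : ℝ) :
    ENNReal.ofReal (shapeOf ν x) = ∫⁻ u in Ioc 0 x, ENNReal.ofReal u ∂ν := by
  refine ofReal_integral_eq_lintegral_ofReal (integrableOn_id_Ioc x) ?_
  filter_upwards [ae_restrict_mem measurableSet_Ioc] with u hu using hu.1.le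

lemma lintegral_Ioi_rpow_neg_two {c : ℝ} (hc : 0 < c) :
    ∫⁻ v in Ioi c, ENNReal.ofReal (v ^ (-2 : ℝ)) = (ENNReal.ofReal c)⁻¹ := by
  rw [← ofReal_integral_eq_lintegral_ofReal (integrableOn_Ioi_rpow_of_lt (by norm_num) hc),
    integral_Ioi_rpow_of_lt (by norm_num) hc, ← ENNReal.ofReal_inv_of_pos hc]
  · congr 1
    norm_num [Real.rpow_neg_one]
  · filter_upwards [ae_restrict_mem measurableSet_Ioi] with v hv
    exact Real.rpow_nonneg (hc.trans hv).le _

/-- For a shape function `shapeOf ν`, no assumption on the dependence of the p-value `U` and the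
volume `V` is needed: write `1 / V = ∫_{v > V} v⁻² dv`, bound the rejection indicator at `V` by the
one at `v`, use that `U` is superuniform, and evaluate `∫ v⁻² shapeOf ν v dv = 1` by Tonelli. -/
lemma lintegral_rejectionWeight_shapeOf_le {Ω : Type*} [MeasurableSpace Ω] {P : Measure Ω}
    [IsProbabilityMeasure P] [IsProbabilityMeasure ν] {U V : Ω → ℝ} (hU : Measurable U)
    (hUpos : ∀ ω, 0 < U ω) (hUle : ∀ u, P {ω | U ω ≤ u} ≤ ENNReal.ofReal u) {α : ℝ} (hα : 0 ≤ α) :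
    ∫⁻ ω, rejectionWeight (fun v => α * shapeOf ν v) (U ω) (V ω) ∂P ≤ ENNReal.ofReal α := by
  set b : ℝ → ℝ := fun v => α * shapeOf ν v
  have hb : Monotone b := fun x y hxy => mul_le_mul_of_nonneg_left (shapeOf_mono hxy) hα
  set κ : ℝ → ℝ≥0∞ := fun v => ENNReal.ofReal (v ^ (-2 : ℝ))
  have hκ : Measurable κ := by fun_prop
  set J : Ω × ℝ → ℝ≥0∞ := {q : Ω × ℝ | U q.1 ≤ b q.2}.indicator 1
  have hJ : Measurable J := measurable_one.indicator
    (measurableSet_le (hU.comp measurable_fst) (hb.measurable.comp measurable_snd))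
  set K : ℝ × ℝ → ℝ≥0∞ := {q : ℝ × ℝ | q.2 ∈ Ioc 0 q.1}.indicator fun q => ENNReal.ofReal q.2
  have hK : Measurable K := measurable_snd.ennreal_ofReal.indicator
    ((measurableSet_lt measurable_const measurable_snd).inter
      (measurableSet_le measurable_snd measurable_fst))
  have hpt (ω : Ω) : rejectionWeight b (U ω) (V ω) ≤ ∫⁻ v in Ioi 0, κ v * J (ω, v) := by
    unfold rejectionWeight
    split_ifs with h
    · have hV : 0 < V ω := by
        by_contra! hV
        have h0 : b (V ω) = 0 := by simp [b, shapeOf_of_nonpos hV]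
        exact (hUpos ω).not_ge (h.trans h0.le)
      rw [← lintegral_Ioi_rpow_neg_two hV]
      refine le_trans (setLIntegral_mono' measurableSet_Ioi fun v (hv : V ω < v) => ?_)
        (lintegral_mono_set (Ioi_subset_Ioi hV.le))
      have hmem : (ω, v) ∈ {q : Ω × ℝ | U q.1 ≤ b q.2} := h.trans (hb hv.le)
      simp only [J, indicator_of_mem hmem, Pi.one_apply, mul_one, κ, le_refl]
    · exact zero_le
  have hsuper (v : ℝ) : ∫⁻ ω, J (ω, v) ∂P ≤
      ENNReal.ofReal α * ∫⁻ u in Ioc 0 v, ENNReal.ofReal u ∂ν := by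
    have hsec : MeasurableSet {ω | U ω ≤ b v} := measurableSet_le hU measurable_const
    have h1 : ∫⁻ ω, J (ω, v) ∂P = P {ω | U ω ≤ b v} := lintegral_indicator_one hsec
    rw [h1, ← ofReal_shapeOf, ← ENNReal.ofReal_mul hα]
    exact hUle _
  have hinner (u : ℝ) : ∫⁻ v in Ioi 0, κ v * K (v, u) ≤ 1 := by
    rcases le_or_gt u 0 with hu | hu
    · have hzero (v : ℝ) : K (v, u) = 0 := indicator_of_notMem (fun h => hu.not_gt h.1) _
      simp [hzero]
    · have hle (v : ℝ) : κ v * K (v, u) =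
          (Ici u).indicator (fun v => κ v * ENNReal.ofReal u) v := by
        by_cases h : u ≤ v
        · have h' : (v, u) ∈ {q : ℝ × ℝ | q.2 ∈ Ioc 0 q.1} := ⟨hu, h⟩
          simp only [K, indicator_of_mem h', indicator_of_mem (show v ∈ Ici u from h)]
        · have h' : (v, u) ∉ {q : ℝ × ℝ | q.2 ∈ Ioc 0 q.1} := fun h' => h h'.2
          simp only [K, indicator_of_notMem h', indicator_of_notMem (show v ∉ Ici u from h),
            mul_zero]
      rw [lintegral_congr hle]
      refine (setLIntegral_le_lintegral _ _).trans ?_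
      rw [lintegral_indicator measurableSet_Ici, setLIntegral_congr Ioi_ae_eq_Ici.symm,
        lintegral_mul_const _ hκ, lintegral_Ioi_rpow_neg_two hu,
        ENNReal.inv_mul_cancel (by simpa using hu) ENNReal.ofReal_ne_top]
  calc ∫⁻ ω, rejectionWeight b (U ω) (V ω) ∂P
      ≤ ∫⁻ ω, ∫⁻ v in Ioi 0, κ v * J (ω, v) ∂volume ∂P := lintegral_mono hpt
    _ = ∫⁻ v in Ioi 0, ∫⁻ ω, κ v * J (ω, v) ∂P ∂volume :=
        lintegral_lintegral_swap ((hκ.comp measurable_snd).mul hJ).aemeasurable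
    _ ≤ ∫⁻ v in Ioi 0, ENNReal.ofReal α * ∫⁻ u, κ v * K (v, u) ∂ν ∂volume := by
        refine lintegral_mono fun v => ?_
        have h1 : ∫⁻ u in Ioc 0 v, ENNReal.ofReal u ∂ν = ∫⁻ u, K (v, u) ∂ν :=
          (lintegral_indicator measurableSet_Ioc _).symm
        rw [lintegral_const_mul' _ _ ENNReal.ofReal_ne_top,
          lintegral_const_mul' _ _ ENNReal.ofReal_ne_top, mul_left_comm, ← h1]
        exact mul_le_mul_right (hsuper v) _
    _ = ENNReal.ofReal α * ∫⁻ v in Ioi 0, ∫⁻ u, κ v * K (v, u) ∂ν ∂volume :=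
        lintegral_const_mul' _ _ ENNReal.ofReal_ne_top
    _ = ENNReal.ofReal α * ∫⁻ u, ∫⁻ v in Ioi 0, κ v * K (v, u) ∂volume ∂ν := by
        congr 1
        exact lintegral_lintegral_swap
          (f := fun v u => κ v * K (v, u)) ((hκ.comp measurable_fst).mul hK).aemeasurable
    _ ≤ ENNReal.ofReal α * ∫⁻ _, 1 ∂ν := mul_le_mul_right (lintegral_mono hinner) _
    _ = ENNReal.ofReal α := by simp

end Shape

/-! ### Gaussian processes with nonnegative covariances -/

section Gaussian

/-- If the volume `v` of the rejection set is a nondecreasing function of a single Gaussian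
observation with mean at most `0`, then `v` is on the rejection event at least `1 / α` times the
probability of that event. -/
lemma lintegral_rejectionWeight_gaussianReal_le {v b : ℝ → ℝ} (hv : Monotone v)
    (hv0 : ∀ x, 0 ≤ v x) {α : ℝ} (hα : 0 < α) (hb : ∀ x, 0 ≤ x → b x = α * x) {m : ℝ}
    (hm : m ≤ 0) :
    ∫⁻ x, rejectionWeight b (gaussianUpperTail x) (v x) ∂(gaussianReal m 1) ≤
      ENNReal.ofReal α := by
  have hshift : gaussianReal m 1 = (gaussianReal 0 1).map (· + m) := by
    rw [gaussianReal_map_add_const, zero_add]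
  have hbm : MeasurableEmbedding fun x : ℝ => x + m := measurableEmbedding_addRight m
  rw [hshift, hbm.lintegral_map]
  set A := {x | gaussianUpperTail (x + m) ≤ α * v (x + m)}
  have hmono : Monotone fun x => α * v (x + m) := fun x y hxy =>
    mul_le_mul_of_nonneg_left (hv (by linarith)) hα.le
  have hA : MeasurableSet A := by
    refine measurableSet_le (Antitone.measurable fun x y hxy => ?_) hmono.measurable
    exact antitone_gaussianUpperTail (by linarith)
  have hle (x : ℝ) : rejectionWeight b (gaussianUpperTail (x + m)) (v (x + m)) ≤
      A.indicator (fun _ => ENNReal.ofReal α * (gaussianReal 0 1 A)⁻¹) x := by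
    unfold rejectionWeight
    split_ifs with h
    · rw [hb _ (hv0 _)] at h
      have hxA : x ∈ A := h
      have hpos : 0 < v (x + m) := pos_of_mul_pos_right ((gaussianUpperTail_pos _).trans_le h) hα.le
      rw [indicator_of_mem hxA, ← div_eq_mul_inv]
      have hbound : gaussianReal 0 1 A ≤ ENNReal.ofReal (α * v (x + m)) :=
        gaussianReal_tail_le hmono hm h
      calc (ENNReal.ofReal (v (x + m)))⁻¹
          = ENNReal.ofReal α / ENNReal.ofReal (α * v (x + m)) := by
            rw [← ENNReal.ofReal_div_of_pos (by positivity), ← ENNReal.ofReal_inv_of_pos hpos]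
            congr 1
            field_simp
        _ ≤ ENNReal.ofReal α / gaussianReal 0 1 A := ENNReal.div_le_div_left hbound _
    · exact zero_le
  calc ∫⁻ x, rejectionWeight b (gaussianUpperTail (x + m)) (v (x + m)) ∂(gaussianReal 0 1)
      ≤ ∫⁻ x, A.indicator (fun _ => ENNReal.ofReal α * (gaussianReal 0 1 A)⁻¹) x
          ∂(gaussianReal 0 1) := lintegral_mono hle
    _ = ENNReal.ofReal α * ((gaussianReal 0 1 A)⁻¹ * gaussianReal 0 1 A) := by
        rw [lintegral_indicator_const hA, mul_assoc]
    _ ≤ ENNReal.ofReal α := mul_le_of_le_one_right zero_le (ENNReal.inv_mul_le_one _)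

variable {Ω S : Type*} [MeasurableSpace Ω] {P : Measure Ω} [IsProbabilityMeasure P]
  {X : S → Ω → ℝ}

omit [IsProbabilityMeasure P] in
lemma _root_.ProbabilityTheory.IsGaussianProcess.map_eq_gaussianReal (hX : IsGaussianProcess X P)
    (hvar : ∀ t, variance (X t) P = 1) (t : S) :
    P.map (X t) = gaussianReal (∫ ω, X t ω ∂P) 1 := by
  rw [(hX.hasGaussianLaw_eval t).map_eq_gaussianReal, hvar, Real.toNNReal_one]

omit [IsProbabilityMeasure P] in
lemma measure_gaussianUpperTail_le (hX : IsGaussianProcess X P)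
    (hvar : ∀ t, variance (X t) P = 1) {t : S} (hXt : Measurable (X t))
    (hmean : ∫ ω, X t ω ∂P ≤ 0) (u : ℝ) :
    P {ω | gaussianUpperTail (X t ω) ≤ u} ≤ ENNReal.ofReal u := by
  have hset : MeasurableSet {x | gaussianUpperTail x ≤ u} :=
    measurableSet_le antitone_gaussianUpperTail.measurable measurable_const
  have h1 : P {ω | gaussianUpperTail (X t ω) ≤ u} = P.map (X t) {x | gaussianUpperTail x ≤ u} :=
    (Measure.map_apply hXt hset).symm
  rw [h1, hX.map_eq_gaussianReal hvar]
  set m := ∫ ω, X t ω ∂P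
  have hshift : gaussianReal m 1 = (gaussianReal 0 1).map (· + m) := by
    rw [gaussianReal_map_add_const, zero_add]
  rw [hshift, Measure.map_apply (by fun_prop) hset]
  rcases ((· + m) ⁻¹' {x | gaussianUpperTail x ≤ u}).eq_empty_or_nonempty with h0 | ⟨a, ha⟩
  · simp [h0]
  · exact gaussianReal_tail_le (v := fun _ => u) monotone_const hmean ha

/-- The residual process of the regression on `X t` is independent of `X t`. -/
lemma indepFun_residual (hX : IsGaussianProcess X P) (hvar : ∀ t, variance (X t) P = 1)
    (hXm : ∀ s, Measurable (X s)) (t : S) :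
    IndepFun (X t) (fun ω s => X s ω - covariance (X s) (X t) P * X t ω) P := by
  set Z : S → Ω → ℝ := fun s ω => X s ω - covariance (X s) (X t) P * X t ω
  have hmem (s : S) : MemLp (X s) 2 P := (hX.hasGaussianLaw_eval s).memLp_two
  have hjoint : IsGaussianProcess (Sum.elim (fun _ : Unit => X t) Z) P := by
    classical
    refine hX.of_isGaussianProcess fun i => ?_
    rcases i with _ | s
    · exact ⟨{t}, ContinuousLinearMap.proj ⟨t, by simp⟩, fun ω => rfl⟩
    · refine ⟨{s, t}, ContinuousLinearMap.proj ⟨s, by simp⟩ -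
        covariance (X s) (X t) P • ContinuousLinearMap.proj ⟨t, by simp⟩, fun ω => ?_⟩
      simp [Z]
  have hcov (s : S) : covariance (X t) (Z s) P = 0 := by
    have h1 : MemLp (fun ω => covariance (X s) (X t) P * X t ω) 2 P := (hmem t).const_mul _
    simp only [Z]
    rw [covariance_fun_sub_right (hmem t) (hmem s) h1, covariance_const_mul_right,
      covariance_self (hXm t).aemeasurable, hvar, mul_one, covariance_comm, sub_self]
  have hindep := hjoint.indepFun_of_covariance_eq_zero (fun _ => (hXm t).aemeasurable)
    (fun s => ((hXm s).sub ((hXm t).const_mul _)).aemeasurable) (fun _ s => hcov s)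
  exact hindep.comp (φ := fun w : Unit → ℝ => w ()) (measurable_pi_apply _) measurable_id

variable [MeasurableSpace S] {Λ : Measure S} [IsProbabilityMeasure Λ]

lemma measurable_covariance_left (hXm : Measurable fun q : Ω × S => X q.2 q.1) (t : S) :
    Measurable fun s => covariance (X s) (X t) P := by
  have hmean : Measurable fun s => ∫ ω, X s ω ∂P :=
    (StronglyMeasurable.integral_prod_left' (μ := P) hXm.stronglyMeasurable).measurable
  have hXt : Measurable (X t) := hXm.comp measurable_prodMk_right
  have h1 : Measurable fun q : Ω × S =>
      (X q.2 q.1 - ∫ ω, X q.2 ω ∂P) * (X t q.1 - ∫ ω, X t ω ∂P) :=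
    (hXm.sub (hmean.comp measurable_snd)).mul ((hXt.comp measurable_fst).sub_const _)
  exact (StronglyMeasurable.integral_prod_left' (μ := P) h1.stronglyMeasurable).measurable

/-- Under nonnegative covariances, write `X s = Z s + c s * X t` with `c s ≥ 0` and the residual
path `Z` independent of `X t`. Given `Z`, the step-up radius is a nondecreasing function of `X t`,
so the bound for a single Gaussian observation applies conditionally on `Z`. -/
lemma lintegral_rejectionWeight_le_of_covariance_nonneg (hX : IsGaussianProcess X P)
    (hXm : Measurable fun q : Ω × S => X q.2 q.1) (hvar : ∀ t, variance (X t) P = 1)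
    (hcov : ∀ s t, 0 ≤ covariance (X s) (X t) P) {α : ℝ} (hα : 0 < α) {b : ℝ → ℝ}
    (hb : Monotone b) (hbc : ∀ x, ContinuousWithinAt b (Ici x) x)
    (hbα : ∀ x, 0 ≤ x → b x = α * x) {t : S} (hmean : ∫ ω, X t ω ∂P ≤ 0) :
    ∫⁻ ω, rejectionWeight b (gaussianUpperTail (X t ω))
      (stepUpRadius Λ (fun s => gaussianUpperTail (X s ω)) fun _ => b) ∂P ≤ ENNReal.ofReal α := by
  have hXs (s : S) : Measurable (X s) := hXm.comp measurable_prodMk_right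
  have hΦ : Measurable gaussianUpperTail := antitone_gaussianUpperTail.measurable
  set c : S → ℝ := fun s => covariance (X s) (X t) P
  have hc : Measurable c := measurable_covariance_left hXm t
  set Z : Ω × S → ℝ := fun q => X q.2 q.1 - c q.2 * X t q.1
  have hZ : Measurable Z :=
    hXm.sub ((hc.comp measurable_snd).mul ((hXs t).comp measurable_fst))
  set T : Ω → S → ℝ := fun ω s => Z (ω, s)
  have hT : Measurable T := measurable_pi_lambda _ fun s => hZ.comp measurable_prodMk_right
  obtain ⟨h, hh, hZh⟩ := exists_measurable_path_version P Λ hZ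
  -- the step-up radius as a function of `x = X t` and the residual path `w`
  set ρ : ℝ × (S → ℝ) → ℝ := fun q =>
    stepUpRadius Λ (fun s => gaussianUpperTail (h (q.2, s) + c s * q.1)) fun _ => b
  have hp : Measurable fun q : (ℝ × (S → ℝ)) × S =>
      gaussianUpperTail (h (q.1.2, q.2) + c q.2 * q.1.1) := by
    have h1 : Measurable fun q : (ℝ × (S → ℝ)) × S => (q.1.2, q.2) :=
      (measurable_snd.comp measurable_fst).prodMk measurable_snd
    exact hΦ.comp ((hh.comp h1).add
      ((hc.comp measurable_snd).mul (measurable_fst.comp measurable_fst)))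
  have hρ : Measurable ρ := by
    have := measurable_stepUpRadius (Λ := Λ) hp hb hbc
    exact this
  have hsec (q : ℝ × (S → ℝ)) :
      Measurable fun s => gaussianUpperTail (h (q.2, s) + c s * q.1) :=
    hp.comp measurable_prodMk_left
  have hρ0 (q : ℝ × (S → ℝ)) : 0 ≤ ρ q := stepUpRadius_nonneg (hsec q) hb hbc
  have hρmono (w : S → ℝ) : Monotone fun x => ρ (x, w) := fun x y hxy => by
    refine stepUpRadius_le_of_le (hsec (x, w)) (hsec (y, w)) hb hbc fun s => ?_
    exact antitone_gaussianUpperTail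
      (add_le_add_right (mul_le_mul_of_nonneg_left hxy (hcov s t)) _)
  have hF : Measurable fun q : ℝ × (S → ℝ) => rejectionWeight b (gaussianUpperTail q.1) (ρ q) :=
    (measurable_rejectionWeight hb.measurable).comp ((hΦ.comp measurable_fst).prodMk hρ)
  have hradius : ∀ᵐ ω ∂P, (stepUpRadius Λ (fun s => gaussianUpperTail (X s ω)) fun _ => b) =
      ρ (X t ω, T ω) := by
    filter_upwards [hZh] with ω hω
    refine stepUpRadius_congr_ae ?_
    filter_upwards [hω] with s hs
    have hXeq : X s ω = h (T ω, s) + c s * X t ω := by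
      rw [← hs]
      simp only [Z]
      ring
    rw [hXeq]
  have hindep : P.map (fun ω => (X t ω, T ω)) = (P.map (X t)).prod (P.map T) :=
    (indepFun_iff_map_prod_eq_prod_map_map (hXs t).aemeasurable hT.aemeasurable).1
      (indepFun_residual hX hvar hXs t)
  have : IsProbabilityMeasure (P.map T) := Measure.isProbabilityMeasure_map hT.aemeasurable
  have : IsProbabilityMeasure (P.map (X t)) :=
    Measure.isProbabilityMeasure_map (hXs t).aemeasurable
  calc ∫⁻ ω, rejectionWeight b (gaussianUpperTail (X t ω))
        (stepUpRadius Λ (fun s => gaussianUpperTail (X s ω)) fun _ => b) ∂P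
      = ∫⁻ ω, rejectionWeight b (gaussianUpperTail (X t ω)) (ρ (X t ω, T ω)) ∂P := by
        refine lintegral_congr_ae ?_
        filter_upwards [hradius] with ω hω
        rw [hω]
    _ = ∫⁻ q, rejectionWeight b (gaussianUpperTail q.1) (ρ q)
          ∂(P.map fun ω => (X t ω, T ω)) :=
        (lintegral_map hF ((hXs t).prodMk hT)).symm
    _ = ∫⁻ w, ∫⁻ x, rejectionWeight b (gaussianUpperTail x) (ρ (x, w)) ∂(P.map (X t))
          ∂(P.map T) := by
        rw [hindep, lintegral_prod_symm' _ hF]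
    _ ≤ ∫⁻ _, ENNReal.ofReal α ∂(P.map T) := by
        refine lintegral_mono fun w => ?_
        rw [hX.map_eq_gaussianReal hvar]
        exact lintegral_rejectionWeight_gaussianReal_le (hρmono w) (fun x => hρ0 (x, w)) hα hbα
          hmean
    _ = ENNReal.ofReal α := by simp

end Gaussian

end ContFDR

theorem corollary4p2 {Ω : Type*} [MeasurableSpace Ω] (P : Measure Ω) [IsProbabilityMeasure P]
    (d : ℕ) (X : ContFDR.Cube d → Ω → ℝ)
    (hGauss : IsGaussianProcess X P)
    (hmeas : Measurable (fun q : Ω × ContFDR.Cube d => X q.2 q.1))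
    (μ : ContFDR.Cube d → ℝ) (hμ : Measurable μ) (hmean : ∀ t, ∫ ω, X t ω ∂P = μ t)
    (hvar : ∀ t, variance (X t) P = 1)
    (α : ℝ) (hα0 : 0 < α) (hα1 : α < 1)
    (β : ℝ → ℝ)
    (hβ : ((∀ x, 0 ≤ x → β x = x) ∧ ∀ s t, 0 ≤ covariance (X s) (X t) P) ∨
      ∃ ν : Measure ℝ, IsProbabilityMeasure ν ∧ ν (Set.Iic 0) = 0 ∧
        ∀ x, 0 ≤ x → β x = ContFDR.shapeOf ν x) :
    (∀ ω, IsGreatest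
      {r : ℝ | r ∈ Set.Icc (0 : ℝ) 1 ∧
        r ≤ volume.real {t : ContFDR.Cube d | ContFDR.gaussianUpperTail (X t ω) ≤ α * β r}}
      (ContFDR.gaussianRadius X α β ω)) ∧
    ContFDR.IsTestingProcedure (ContFDR.gaussianStepUp X α β) ∧
    Integrable
      (fun ω => ContFDR.fdp volume {t | μ t ≤ 0} (ContFDR.gaussianStepUp X α β ω)) P ∧
    ContFDR.fdr P volume {t | μ t ≤ 0} (ContFDR.gaussianStepUp X α β) ≤ α := by
  open ContFDR Set in
  have hp : Measurable fun q : Ω × Cube d => gaussianUpperTail (X q.2 q.1) :=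
    antitone_gaussianUpperTail.measurable.comp hmeas
  have hH₀ : MeasurableSet {t | μ t ≤ 0} := measurableSet_le hμ measurable_const
  -- a monotone right-continuous function on the whole line that extends the threshold
  obtain ⟨b, hb, hbc, hbβ, hweight⟩ : ∃ b : ℝ → ℝ, Monotone b ∧
      (∀ x, ContinuousWithinAt b (Ici x) x) ∧ (∀ x, 0 ≤ x → α * β x = b x) ∧
      ∀ t ∈ {t | μ t ≤ 0}, ∫⁻ ω, rejectionWeight b (gaussianUpperTail (X t ω))
        (stepUpRadius volume (fun t => gaussianUpperTail (X t ω)) fun _ => b) ∂P ≤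
          ENNReal.ofReal α := by
    rcases hβ with ⟨hβ, hcov⟩ | ⟨ν, hν, -, hβ⟩
    · have hb : Monotone fun x : ℝ => α * max x 0 := fun x y hxy =>
        mul_le_mul_of_nonneg_left (max_le_max_right 0 hxy) hα0.le
      have hbc : Continuous fun x : ℝ => α * max x 0 := by fun_prop
      refine ⟨_, hb, fun x => hbc.continuousWithinAt, fun x hx => ?_, fun t ht => ?_⟩
      · simp only [hβ x hx, max_eq_left hx]
      · refine lintegral_rejectionWeight_le_of_covariance_nonneg hGauss hmeas hvar hcov hα0 hb
          (fun x => hbc.continuousWithinAt) (fun x hx => ?_) ((hmean t).trans_le ht)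
        simp only [max_eq_left hx]
    · refine ⟨fun x => α * shapeOf ν x,
        fun x y hxy => mul_le_mul_of_nonneg_left (shapeOf_mono hxy) hα0.le,
        fun x => (continuousWithinAt_shapeOf x).const_mul α, fun x hx => by rw [hβ x hx],
        fun t ht => ?_⟩
      have hXt : Measurable (X t) := hmeas.comp measurable_prodMk_right
      exact lintegral_rejectionWeight_shapeOf_le
        (antitone_gaussianUpperTail.measurable.comp hXt) (fun ω => gaussianUpperTail_pos _)
        (measure_gaussianUpperTail_le hGauss hvar hXt ((hmean t).trans_le ht)) hα0.le
  have hthreshold (t : Cube d) (r : ℝ) (hr : 0 ≤ r) :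
      productThreshold α (fun _ => 1) β t r = b r := by
    rw [productThreshold, mul_one, hbβ r hr]
  have hradius (ω : Ω) : gaussianRadius X α β ω =
      stepUpRadius volume (fun t => gaussianUpperTail (X t ω)) fun _ => b :=
    stepUpRadius_congr_threshold hthreshold
  have hspec (ω : Ω) := stepUpRadius_spec (Λ := (volume : Measure (Cube d)))
    (p := fun t => gaussianUpperTail (X t ω)) (hp.comp (measurable_prodMk_left (x := ω))) hb hbc
  have hstep : gaussianStepUp X α β =
      fun ω => stepUp volume (fun t => gaussianUpperTail (X t ω)) fun _ => b := by
    ext ω t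
    have h0 : 0 ≤ gaussianRadius X α β ω := (hradius ω).symm ▸ (hspec ω).1.1.1
    have h1 : productThreshold α (fun _ => 1) β t (gaussianRadius X α β ω) =
        b (stepUpRadius volume (fun t => gaussianUpperTail (X t ω)) fun _ => b) := by
      rw [hthreshold t _ h0, hradius]
    exact iff_of_eq (congrArg (gaussianUpperTail (X t ω) ≤ ·) h1)
  have htest : IsTestingProcedure (gaussianStepUp X α β) := by
    rw [hstep]
    exact measurableSet_stepUp hp hb hbc
  refine ⟨fun ω => ?_, htest, integrable_fdp htest hH₀, ?_⟩
  · rw [hradius]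
    obtain ⟨⟨h0, hle⟩, hub⟩ := (hspec ω).1
    refine ⟨⟨⟨h0, hle.trans measureReal_le_one⟩, ?_⟩, fun r hr => hub ⟨hr.1.1, ?_⟩⟩
    · rw [hbβ _ h0]
      exact hle
    · rw [← hbβ r hr.1.1]
      exact hr.2
  · rw [hstep]
    exact fdr_stepUp_le hp hb hbc hH₀ hα0.le hweight
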